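/- **Theorem 4.1.** Let $x=(x_1,x_2,\dots)$, $\partial_i=\partial/\partial x_i$ and $\partial=\partial_1$. Consider formal power series $\xi_1,\xi_2,\ldots\in\mathbb C[[x_1,x_2,\dots]]$ such that $$\psi(x,k)=\exp\Big(\sum_{j\ge1}x_jk^j\Big)\Big(1+\sum_{i\ge1}\xi_i(x)k^{-i}\Big)$$ is a solution of the KP hierarchy, that is, for every $n\ge1$ there are $B_n^2,\dots,B_n^n\in\mathbb C[[x_1,x_2,\dots]]$ with $$\partial_n\psi=\Big(\partial^n+\sum_{i=2}^{n}B_n^i\,\partial^{\,n-i}\Big)\psi .$$ Let $\tau\in\mathbb C[[x_1,x_2,\dots]]$ be a series with non-zero constant term such that $$\psi(x,k)=\exp\Big(\sum_{j\ge1} x_jk^j\Big)\,\frac{\tau\big(x_1-k^{-1},\,x_2-\tfrac12k^{-2},\,x_3-\tfrac13k^{-3},\dots\big)}{\tau(x_1,x_2,x_3,\dots)},$$ let $v=-\ln\tau$ (for any choice of the logarithm of the constant term), and define $\eta_1,\eta_2,\dots$ by $\ln\psi=\sum_{j\ge1}x_jk^j+\sum_{r\ge1}\eta_r(x)k^{-r}$.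 There exist rational coefficients $$R_r\begin{pmatrix}s_1&\cdots&s_n\\t_1&\cdots&t_n\end{pmatrix},\qquad R_{ij}\begin{pmatrix}s_1&\cdots&s_n\\t_1&\cdots&t_n\end{pmatrix}\qquad(r,i,j\ge1),$$ which are universal (they do not depend on $\psi$, $\tau$, $v$), such that for all such $\psi,\tau,v$ and all $r,i,j\ge1$ $$\eta_r=\frac1r\,\partial_rv+\sum_{n\ge1}\sum R_r\begin{pmatrix}s_1&\cdots&s_n\\t_1&\cdots&t_n\end{pmatrix}\partial_{s_1}\partial^{t_1}v\cdots\partial_{s_n}\partial^{t_n}v,$$ $$\partial_i\partial_jv=\sum_{n\ge1}\sum R_{ij}\begin{pmatrix}s_1&\cdots&s_n\\t_1&\cdots&t_n\end{pmatrix}\partial_{s_1}\partial^{t_1}v\cdots\partial_{s_n}\partial^{t_n}v,$$ where the inner sums are over the matrices with integer entries $s_m,t_m\ge1$ whose total sum $s_1+\dots+s_n+t_1+\dots+t_n$ equals $r$ in the first formula and $i+j$ in the second. In other words, $\eta_r-\frac1r\partial_rv$ and $\partial_i\partial_jv$ are universal polynomials with rational coefficients in the $\partial_s\partial^tv$ ($s,t\ge1$),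 weighted homogeneous of weight $r$ and $i+j$ respectively, where $\partial_s\partial^tv$ has weight $s+t$. -/

import Mathlib

noncomputable section

namespace KP

/-- Formal functions `f(x)` of infinitely many variables `x = (x₁, x₂, …)`:
the ring `ℂ⟦x₁, x₂, …⟧`. -/
abbrev Fn : Type := MvPowerSeries ℕ+ ℂ

/-- The ring `ℂ⟦κ, x₁, x₂, …⟧`, where `κ = k⁻¹` is the variable with index `none` and
`x_j` is the variable with index `some j`. -/
abbrev FnK : Type := MvPowerSeries (Option ℕ+) ℂ

/-- The ring `ℂ((k⁻¹))⟦x₁, x₂, …⟧`, in which the function `ψ(x, k)` lives.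
A `LaurentSeries ℂ` is here a Laurent series in `κ = k⁻¹`, so the number `k ^ m` is
`HahnSeries.single (-m) 1`. -/
abbrev WaveFn : Type := MvPowerSeries ℕ+ (LaurentSeries ℂ)

/-- The partial derivative `∂_j = ∂/∂x_j` of functions of `x`. -/
abbrev D (j : ℕ+) (f : Fn) : Fn := MvPowerSeries.pderiv ℂ j f

/-- The partial derivative `∂_j = ∂/∂x_j` of functions of `x` and `k`. -/
abbrev DW (j : ℕ+) (f : WaveFn) : WaveFn := MvPowerSeries.pderiv (LaurentSeries ℂ) j f

/-- The series `∑_{i ≥ 1} a_i(x) k⁻ⁱ`. -/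
def genSeries (a : ℕ+ → Fn) : FnK := fun d =>
  if h : 0 < d none then MvPowerSeries.coeff d.some (a ⟨d none, h⟩) else 0

/-- The coefficient of `k⁻ʳ`, a function of `x`, of an element of `ℂ⟦k⁻¹, x⟧`. -/
def kCoeff (r : ℕ) (F : FnK) : Fn := fun a => MvPowerSeries.coeff (a.optionElim r) F

/-- The inclusion `ℂ⟦k⁻¹, x⟧ ⊆ ℂ((k⁻¹))⟦x⟧`. -/
def toWaveFn (F : FnK) : WaveFn := fun a =>
  HahnSeries.ofPowerSeries ℤ ℂ
    (PowerSeries.mk fun i => MvPowerSeries.coeff (a.optionElim i) F)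

/-- A function `f(x)` regarded as a function of `x` and `k`. -/
def ofFn (f : Fn) : WaveFn :=
  MvPowerSeries.map (HahnSeries.C : ℂ →+* LaurentSeries ℂ) f

/-- The series `exp (∑_{j ≥ 1} x_j k^j) = ∑_a ∏_j (x_j k^j)^{a_j} / a_j!`
(sum over all multi-indices `a`). -/
def planeWave : WaveFn := fun a =>
  HahnSeries.single (-(a.sum fun j m => (j : ℤ) * (m : ℤ)))
    (a.prod fun _ m => ((m.factorial : ℂ))⁻¹)

/-- The function `ψ(x, k) = exp (∑ x_j k^j) (1 + ∑_{i ≥ 1} ξ_i(x) k⁻ⁱ)`. -/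
def waveFunction (ξ : ℕ+ → Fn) : WaveFn :=
  planeWave * toWaveFn (1 + genSeries ξ)

/-- `ψ` solves the KP hierarchy: for every `n ≥ 1` there is a differential operator
`L_n = ∂₁ⁿ + ∑_{i=2}^{n} B_n^i(x) ∂₁^{n-i}` with `∂ψ/∂x_n = L_n ψ`. -/
def IsKPSolution (ξ : ℕ+ → Fn) : Prop :=
  ∃ B : ℕ+ → ℕ → Fn, ∀ n : ℕ+,
    DW n (waveFunction ξ) =
      (DW 1)^[n] (waveFunction ξ) +
        ∑ i ∈ Finset.Icc 2 (n : ℕ), ofFn (B n i) * (DW 1)^[n - i] (waveFunction ξ)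

/-- `f(x)` regarded as an element of `ℂ⟦k⁻¹, x⟧`. -/
def incl (f : Fn) : FnK :=
  MvPowerSeries.subst (fun j : ℕ+ => (MvPowerSeries.X (some j) : FnK)) f

/-- The series `f(x₁ - k⁻¹, x₂ - k⁻²/2, x₃ - k⁻³/3, …)`. -/
def shift (f : Fn) : FnK :=
  MvPowerSeries.subst (fun j : ℕ+ =>
    (MvPowerSeries.X (some j) -
      MvPowerSeries.C ((j : ℂ)⁻¹) * MvPowerSeries.X none ^ (j : ℕ) : FnK)) f

/-- `τ` is a tau function of `ψ`:
`ψ(x, k) = exp (∑ x_j k^j) τ(x₁ - k⁻¹, x₂ - k⁻²/2, …) / τ(x₁, x₂, …)`. -/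
def IsTauFunction (ξ : ℕ+ → Fn) (τ : Fn) : Prop :=
  (1 + genSeries ξ) * incl τ = shift τ

/-- `ln F = ∑_{n ≥ 1} (-1)^{n+1} (F - 1)^n / n` for a formal power series `F` with constant
term `1`. -/
def logOne {σ : Type} (F : MvPowerSeries σ ℂ) : MvPowerSeries σ ℂ :=
  (PowerSeries.log ℂ).subst (F - 1)

/-- `g` is a (branch of the) logarithm of the formal power series `f`: the constant term `c` of
`g` is a logarithm of the constant term of `f`, and `g = c + ln (f / e^c)`. In particular the
constant term of `f` is not zero. -/
def IsLog (g f : Fn) : Prop :=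
  ∃ c : ℂ, Complex.exp c = MvPowerSeries.constantCoeff f ∧
    g = MvPowerSeries.C c + logOne (MvPowerSeries.C (Complex.exp (-c)) * f)

/-- The functions `η_r(x)`, defined by `ln ψ(x, k) = ∑ x_j k^j + ∑_{r ≥ 1} η_r(x) k⁻ʳ`, that is,
`∑_{r ≥ 1} η_r k⁻ʳ = ln (1 + ∑_{i ≥ 1} ξ_i k⁻ⁱ)`. -/
def eta (ξ : ℕ+ → Fn) (r : ℕ+) : Fn := kCoeff r (logOne (1 + genSeries ξ))

/-- The weight `s + t` of the variable with index `(s, t)`, which stands for `∂_s ∂₁ᵗ v`. -/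
def wt (p : ℕ+ × ℕ+) : ℕ := (p.1 : ℕ) + (p.2 : ℕ)

/-- The value of the polynomial `P` with rational coefficients at the functions `∂_s ∂₁ᵗ v`
(`s, t ≥ 1`). -/
def evalAt (v : Fn) (P : MvPolynomial (ℕ+ × ℕ+) ℚ) : Fn :=
  MvPolynomial.aeval (fun p : ℕ+ × ℕ+ => D p.1 ((D 1)^[(p.2 : ℕ)] v)) P

end KP

end

/-!
Write `κ = k⁻¹`, and let `h_r(f)` be the coefficient of `κʳ` in
`f(x₁ - κ, x₂ - κ²/2, x₃ - κ³/3, …)`. Taking logarithms in the definition of the tau function gives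
`∑ η_r κʳ = v(x) - v(x₁ - κ, x₂ - κ²/2, …)`, that is, `η_r = -h_r(v)` for `r ≥ 1`
(`KP.logOne_one_add_genSeries`). Differentiating the shifted function with respect to `κ` gives
Newton's recursion `r h_r(f) = -∑_{j=1}^{r} h_{r-j}(∂_j f)` (`KP.succ_smul_kCoeff_shift`), so that
`η_r` is `r⁻¹ ∂_r v` plus a rational combination of derivatives of `v` of order at least two and
total weight `r`. It remains to express the second derivatives of `v`.

Dividing the KP equation by `kⁿ ψ` gives
`1 + κⁿ ∂_n ∑ η_r κʳ = p_n + ∑_{i=2}^{n} B_n^i κⁱ p_{n-i}`, where the coefficients of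
`p_n = κⁿ (∂₁ⁿ ψ) / ψ` are weighted homogeneous polynomials in the `∂₁ᵃ η_r` with `a ≥ 1`
(`KP.expansion_of_kp`). The coefficients of `κ², …, κⁿ` determine the `B_n^i`, and then the
coefficient of `κ^{n+r}` shows that `∂_n η_r` is a polynomial of weight `n + r` in the `∂₁ᵃ η_s`,
`a ≥ 1` (`KP.IsKPExpansion.D_eta_mem_jetSpace`).

The second derivatives are now treated by induction on the weight `N = i + j`
(`KP.IsKPExpansion.D_D_mem_jetSpace`). Suppose that those of weight less than `N` are polynomials in
the `∂_s ∂₁ᵗ v`. Every derivative of `v` of order at least three and weight at most `N` contains a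
second derivative of weight less than `N`, and therefore is such a polynomial as well. Hence so are
the `∂₁ᵃ η_r` with `a ≥ 1` and `a + r ≤ N`: the leading term `r⁻¹ ∂_r ∂₁ᵃ v` is one of the
variables. By the KP equations `∂_j η_i` is a polynomial in them for `i + j = N`, and it differs
from `i⁻¹ ∂_i ∂_j v` by derivatives of order at least three.

The polynomials are universal because the argument is carried out in the `ℚ`-algebra of all families
of functions indexed by the solutions `(ξ, τ, v)`: a polynomial identity there holds for all the
solutions at once.
-/

noncomputable section

namespace KP

/-! ### Weighted homogeneous elements and the induction on the weight -/

section WeightSpace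

variable {A ι : Type*} [CommRing A] [Algebra ℚ A]

/-- The space of weighted homogeneous polynomials of weight `n` with rational coefficients in the
elements `y i`, where `y i` has weight `w i`: the `ℚ`-span of the products of total weight `n`. -/
def weightSpace (y : ι → A) (w : ι → ℕ) (n : ℕ) : Submodule ℚ A :=
  Submodule.span ℚ {x | ∃ m : Multiset ι, (m.map w).sum = n ∧ (m.map y).prod = x}

variable {y : ι → A} {w : ι → ℕ}

theorem prod_mem_weightSpace (m : Multiset ι) :
    (m.map y).prod ∈ weightSpace y w (m.map w).sum :=
  Submodule.subset_span ⟨m, rfl, rfl⟩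

theorem one_mem_weightSpace : (1 : A) ∈ weightSpace y w 0 := by
  simpa using prod_mem_weightSpace (y := y) (w := w) 0

theorem apply_mem_weightSpace (i : ι) : y i ∈ weightSpace y w (w i) := by
  simpa using prod_mem_weightSpace (y := y) (w := w) {i}

theorem mul_mem_weightSpace {a b : ℕ} {f g : A} (hf : f ∈ weightSpace y w a)
    (hg : g ∈ weightSpace y w b) : f * g ∈ weightSpace y w (a + b) := by
  induction hf using Submodule.span_induction with
  | mem f h =>
    obtain ⟨m, rfl, rfl⟩ := h
    induction hg using Submodule.span_induction with
    | mem g h =>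
      obtain ⟨l, rfl, rfl⟩ := h
      simpa using prod_mem_weightSpace (y := y) (w := w) (m + l)
    | zero => simp
    | add _ _ _ _ h₁ h₂ => rw [mul_add]; exact add_mem h₁ h₂
    | smul c _ _ h => rw [mul_smul_comm]; exact Submodule.smul_mem _ c h
  | zero => simp
  | add _ _ _ _ h₁ h₂ => rw [add_mul]; exact add_mem h₁ h₂
  | smul c _ _ h => rw [smul_mul_assoc]; exact Submodule.smul_mem _ c h

theorem exists_isWeightedHomogeneous_of_mem_weightSpace {n : ℕ} {f : A}
    (hf : f ∈ weightSpace y w n) :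
    ∃ P : MvPolynomial ι ℚ, P.IsWeightedHomogeneous w n ∧ MvPolynomial.aeval y P = f := by
  induction hf using Submodule.span_induction with
  | mem f h =>
    obtain ⟨m, rfl, rfl⟩ := h
    refine ⟨(m.map MvPolynomial.X).prod, ?_, by simp [map_multiset_prod]⟩
    induction m using Multiset.induction with
    | empty => simpa using MvPolynomial.isWeightedHomogeneous_one ℚ w
    | cons i m ih => simpa using (MvPolynomial.isWeightedHomogeneous_X ℚ w i).mul ih
  | zero => exact ⟨0, MvPolynomial.isWeightedHomogeneous_zero ℚ w n, map_zero _⟩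
  | add _ _ _ _ h₁ h₂ =>
    obtain ⟨P, hP, rfl⟩ := h₁
    obtain ⟨Q, hQ, rfl⟩ := h₂
    exact ⟨P + Q, hP.add hQ, map_add _ _ _⟩
  | smul c _ _ h =>
    obtain ⟨P, hP, rfl⟩ := h
    exact ⟨c • P, (MvPolynomial.weightedHomogeneousSubmodule ℚ w n).smul_mem c hP, map_smul _ _ _⟩

/-- A derivation that raises the weight of the generators by `k`, as long as the result has weight
at most `N`, does so for all weighted homogeneous polynomials. -/
theorem derivation_mem_weightSpace (d : Derivation ℚ A A) {k N : ℕ}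
    (h : ∀ i, w i + k ≤ N → d (y i) ∈ weightSpace y w (w i + k)) {n : ℕ} (hn : n + k ≤ N) {f : A}
    (hf : f ∈ weightSpace y w n) : d f ∈ weightSpace y w (n + k) := by
  induction hf using Submodule.span_induction with
  | mem f hf =>
    obtain ⟨m, rfl, rfl⟩ := hf
    induction m using Multiset.induction with
    | empty => simp
    | cons i m ih =>
      simp only [Multiset.map_cons, Multiset.sum_cons, Multiset.prod_cons, Derivation.leibniz,
        smul_eq_mul] at hn ⊢
      refine add_mem ?_ ?_
      · rw [add_assoc]
        exact mul_mem_weightSpace (apply_mem_weightSpace i) (ih (by lia))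
      · rw [add_comm (w i), add_assoc]
        exact mul_mem_weightSpace (prod_mem_weightSpace m) (h i (by lia))
  | zero => simp
  | add _ _ _ _ h₁ h₂ => rw [map_add]; exact add_mem h₁ h₂
  | smul c _ _ h => rw [Derivation.map_smul]; exact Submodule.smul_mem _ c h

end WeightSpace

section Hierarchy

variable {A : Type*} [CommRing A] [Algebra ℚ A]

/-- The function `∂_s ∂₁ᵗ v`, where `p = (s, t)`. -/
def jet (D : ℕ+ → Derivation ℚ A A) (v : A) (p : ℕ+ × ℕ+) : A := D p.1 ((D 1)^[(p.2 : ℕ)] v)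

/-- The space of weighted homogeneous polynomials of weight `n` in the `∂_s ∂₁ᵗ v`. -/
def jetSpace (D : ℕ+ → Derivation ℚ A A) (v : A) (n : ℕ) : Submodule ℚ A :=
  weightSpace (jet D v) wt n

/-- `h r f` behaves like the coefficient of `κʳ` in
`f(x₁ - κ, x₂ - κ²/2, x₃ - κ³/3, …)`: the field `succ` compares the coefficients of `κʳ` in
`∂/∂κ f(x₁ - κ, x₂ - κ²/2, …) = -∑_{i ≥ 0} κⁱ (∂_{i+1} f)(x₁ - κ, x₂ - κ²/2, …)`. -/
structure IsShift (D : ℕ+ → Derivation ℚ A A) (h : ℕ → A → A) : Prop where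
  comm : ∀ i j f, D i (D j f) = D j (D i f)
  zero : ∀ f, h 0 f = f
  succ : ∀ (r : ℕ) (f : A), ((r : ℚ) + 1) • h (r + 1) f =
    -∑ p ∈ Finset.HasAntidiagonal.antidiagonal r, h p.2 (D p.1.succPNat f)

variable {D : ℕ+ → Derivation ℚ A A} {v : A} {h : ℕ → A → A}

theorem jet_mem_jetSpace (s : ℕ+) {t : ℕ} (ht : 0 < t) :
    D s ((D 1)^[t] v) ∈ jetSpace D v (s + t) :=
  apply_mem_weightSpace (y := jet D v) (w := wt) (s, ⟨t, ht⟩)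

namespace IsShift

theorem iterate_comm (H : IsShift D h) (i j : ℕ+) (t : ℕ) (f : A) :
    D i ((D j)^[t] f) = (D j)^[t] (D i f) :=
  (Function.Commute.iterate_right (f := D i) (g := D j) (fun f => H.comm i j f) t).eq f

theorem D_one_mem_jetSpace (H : IsShift D h) {n : ℕ} {f : A}
    (hf : f ∈ jetSpace D v n) : D 1 f ∈ jetSpace D v (n + 1) := by
  have hjet : ∀ p : ℕ+ × ℕ+, wt p + 1 ≤ n + 1 →
      D 1 (jet D v p) ∈ weightSpace (jet D v) wt (wt p + 1) := by
    intro p _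
    have := jet_mem_jetSpace (D := D) (v := v) p.1 (Nat.succ_pos p.2)
    rwa [Function.iterate_succ_apply', H.comm] at this
  exact derivation_mem_weightSpace (D 1) hjet le_rfl hf

theorem iterate_D_one_mem_jetSpace (H : IsShift D h) (t : ℕ) {n : ℕ}
    {f : A} (hf : f ∈ jetSpace D v n) : (D 1)^[t] f ∈ jetSpace D v (n + t) := by
  induction t with
  | zero => exact hf
  | succ t ih => rw [Function.iterate_succ_apply']; exact H.D_one_mem_jetSpace ih

/-- If the second derivatives of weight less than `N` are polynomials in the `∂_s ∂₁ᵗ v`, then so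
are all derivatives of weight at most `N` of such polynomials: the inequality in the hypothesis is
strict because `∂_i ∂_s ∂₁ᵗ v` is obtained from `∂_i ∂_s v` by at least one more derivation. -/
theorem D_mem_jetSpace (H : IsShift D h) {N : ℕ}
    (hN : ∀ i j : ℕ+, (i : ℕ) + j < N → D i (D j v) ∈ jetSpace D v (i + j))
    (i : ℕ+) {n : ℕ} (hn : n + i ≤ N) {f : A} (hf : f ∈ jetSpace D v n) :
    D i f ∈ jetSpace D v (n + i) := by
  refine derivation_mem_weightSpace (D i) (fun p hp => ?_) hn hf
  rw [wt] at hp ⊢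
  have := p.2.pos
  rw [jet, H.iterate_comm p.1, H.iterate_comm i,
    show (p.1 : ℕ) + p.2 + i = i + p.1 + p.2 by ring]
  exact H.iterate_D_one_mem_jetSpace _ (hN _ _ (by lia))

/-- The `h_r` commute with the `∂_n`; this follows from the recursion for the `h_r`. -/
theorem apply_D (H : IsShift D h) (n : ℕ+) (r : ℕ) (f : A) : h r (D n f) = D n (h r f) := by
  induction r using Nat.strong_induction_on generalizing f with
  | _ r ih =>
    cases r with
    | zero => simp [H.zero]
    | succ r =>
      have hr : ((r : ℚ) + 1) ≠ 0 := by positivity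
      refine smul_right_injective A hr ?_
      beta_reduce
      rw [H.succ, ← Derivation.map_smul, H.succ, map_neg, map_sum]
      congr 1
      refine Finset.sum_congr rfl fun p hp => ?_
      rw [Finset.HasAntidiagonal.mem_antidiagonal] at hp
      rw [H.comm, ih p.2 (by lia)]

theorem apply_succ_mem (H : IsShift D h) {W : Submodule ℚ A} {r : ℕ} {f : A}
    (hf : ∀ i j, i + j = r → h j (D i.succPNat f) ∈ W) : h (r + 1) f ∈ W := by
  have hr : ((r : ℚ) + 1) ≠ 0 := by positivity
  rw [← W.smul_mem_iff hr, H.succ]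
  exact neg_mem (sum_mem fun p hp => hf _ _ (Finset.HasAntidiagonal.mem_antidiagonal.1 hp))

/-- The leading term of `h_{r+1}(f)` is `-(r + 1)⁻¹ ∂_{r+1} f`: it is the only one in the recursion
in which no further `h_j` with `j ≥ 1` is applied. -/
theorem smul_apply_succ_add_mem (H : IsShift D h) {W : Submodule ℚ A} {r : ℕ} {f : A}
    (hf : ∀ i j, i + j + 1 = r → h (j + 1) (D i.succPNat f) ∈ W) :
    ((r : ℚ) + 1) • h (r + 1) f + D r.succPNat f ∈ W := by
  have hr : (r, 0) ∈ Finset.HasAntidiagonal.antidiagonal r := by simp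
  rw [H.succ, ← Finset.add_sum_erase _ _ hr, H.zero, neg_add, neg_add_cancel_comm]
  refine neg_mem (sum_mem fun p hp => ?_)
  obtain ⟨i, j⟩ := p
  simp only [Finset.mem_erase, Finset.HasAntidiagonal.mem_antidiagonal, ne_eq, Prod.mk.injEq] at hp
  obtain ⟨j, rfl⟩ := Nat.exists_eq_succ_of_ne_zero (n := j) (by lia)
  exact hf i j (by lia)

theorem apply_mem_jetSpace (H : IsShift D h) {N : ℕ}
    (hN : ∀ i j : ℕ+, (i : ℕ) + j < N → D i (D j v) ∈ jetSpace D v (i + j))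
    (r : ℕ) {s : ℕ} (hs : s + r ≤ N) {f : A} (hf : f ∈ jetSpace D v s) :
    h r f ∈ jetSpace D v (s + r) := by
  induction r using Nat.strong_induction_on generalizing f s with
  | _ r ih =>
    cases r with
    | zero => rwa [H.zero]
    | succ r =>
      refine H.apply_succ_mem fun i j hij => ?_
      have := ih j (by lia) (s := s + (i + 1)) (by lia)
        (H.D_mem_jetSpace hN i.succPNat (by simp; lia) hf)
      rwa [show s + (r + 1) = s + (i + 1) + j by lia]

theorem smul_apply_succ_D_add_mem (H : IsShift D h) {N : ℕ}
    (hN : ∀ i j : ℕ+, (i : ℕ) + j < N → D i (D j v) ∈ jetSpace D v (i + j))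
    (n : ℕ+) {r : ℕ} (hr : n + r + 1 ≤ N) :
    ((r : ℚ) + 1) • h (r + 1) (D n v) + D r.succPNat (D n v) ∈ jetSpace D v (n + r + 1) := by
  refine H.smul_apply_succ_add_mem fun i j hij => ?_
  have := H.apply_mem_jetSpace hN (j + 1) (s := i + 1 + n) (by lia)
    (hN i.succPNat n (by simp; lia))
  rwa [show (n : ℕ) + r + 1 = i + 1 + n + (j + 1) by lia]

end IsShift

/-- The equations of the KP hierarchy for the coefficients `η_r` of the logarithm of the wave
function without its exponential factor. Here `p n m` stands for the coefficient of `κᵐ` in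
`p_n = κⁿ (∂₁ⁿ ψ) / ψ`, the fields `succ_zero` and `succ_succ` encode
`p_{n+1} = p_n + κ (∂₁ p_n + p_n ∑ κʳ ∂₁ η_r)`, and `expand` compares the coefficients of `κᵐ`,
`m > 0`, in `1 + κⁿ ∑ κʳ ∂_n η_r = p_n + ∑_{i=2}^{n} B_n^i κⁱ p_{n-i}`. Only the values `B n i` with
`2 ≤ i ≤ n` matter. -/
structure IsKPExpansion (D : ℕ+ → Derivation ℚ A A) (η : ℕ → A) (p : ℕ → ℕ → A)
    (B : ℕ+ → ℕ → A) : Prop where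
  eta_zero : η 0 = 0
  zero_zero : p 0 0 = 1
  zero_succ : ∀ m, p 0 (m + 1) = 0
  succ_zero : ∀ n, p (n + 1) 0 = p n 0
  succ_succ : ∀ n m, p (n + 1) (m + 1) = p n (m + 1) + D 1 (p n m) +
    ∑ q ∈ Finset.HasAntidiagonal.antidiagonal m, p n q.1 * D 1 (η q.2)
  expand : ∀ (n : ℕ+) (m : ℕ), 0 < m → (if (n : ℕ) ≤ m then D n (η (m - n)) else 0) =
    p n m + ∑ i ∈ Finset.Icc 2 (n : ℕ), if i ≤ m then B n i * p (n - i) (m - i) else 0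

namespace IsKPExpansion

variable {η : ℕ → A} {p : ℕ → ℕ → A} {B : ℕ+ → ℕ → A}

theorem apply_zero (K : IsKPExpansion D η p B) (n : ℕ) : p n 0 = 1 := by
  induction n with
  | zero => exact K.zero_zero
  | succ n ih => rw [K.succ_zero, ih]

theorem coeff_mem_jetSpace (K : IsKPExpansion D η p B) (H : IsShift D h) {N : ℕ}
    (hη : ∀ r, r + 1 ≤ N → D 1 (η r) ∈ jetSpace D v (r + 1)) (n : ℕ) {m : ℕ} (hm : m ≤ N) :
    p n m ∈ jetSpace D v m := by
  induction n generalizing m with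
  | zero =>
    cases m with
    | zero => rw [K.zero_zero]; exact one_mem_weightSpace
    | succ m => rw [K.zero_succ]; exact zero_mem _
  | succ n ih =>
    cases m with
    | zero => rw [K.succ_zero]; exact ih hm
    | succ m =>
      rw [K.succ_succ]
      refine add_mem (add_mem (ih hm) (H.D_one_mem_jetSpace (ih (by lia))))
        (sum_mem fun q hq => ?_)
      rw [Finset.HasAntidiagonal.mem_antidiagonal] at hq
      rw [← hq, add_assoc]
      exact mul_mem_weightSpace (ih (by lia)) (hη _ (by lia))

/-- The coefficients of the KP operators are determined recursively by the vanishing of the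
coefficients of `κ², …, κⁿ`. -/
theorem operator_mem_jetSpace (K : IsKPExpansion D η p B) {N : ℕ}
    (hp : ∀ n m, m ≤ N → p n m ∈ jetSpace D v m) (n : ℕ+) {j : ℕ} (hj : 2 ≤ j) (hjn : j ≤ n)
    (hjN : j ≤ N) : B n j ∈ jetSpace D v j := by
  induction j using Nat.strong_induction_on with
  | _ j ih =>
    have hK := K.expand n j (by lia)
    have h_lhs : (if (n : ℕ) ≤ j then D n (η (j - n)) else 0) = 0 := by
      split_ifs with hnj
      · rw [show j - (n : ℕ) = 0 by lia, K.eta_zero, map_zero]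
      · rfl
    have hmem : j ∈ Finset.Icc 2 (n : ℕ) := by simp; lia
    rw [h_lhs, ← Finset.add_sum_erase _ _ hmem, if_pos le_rfl, Nat.sub_self, K.apply_zero,
      mul_one] at hK
    have : B n j = -(p n j + ∑ i ∈ (Finset.Icc 2 (n : ℕ)).erase j,
        if i ≤ j then B n i * p (n - i) (j - i) else 0) := by
      linear_combination -hK
    rw [this]
    refine neg_mem (add_mem (hp _ _ hjN) (sum_mem fun i hi => ?_))
    simp only [Finset.mem_erase, Finset.mem_Icc, ne_eq] at hi
    split_ifs with hij
    · have := mul_mem_weightSpace (ih i (by lia) (by lia) (by lia) (by lia))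
        (hp (n - i) (j - i) (by lia))
      rwa [show i + (j - i) = j by lia] at this
    · exact zero_mem _

theorem D_eta_mem_jetSpace (K : IsKPExpansion D η p B) {N : ℕ}
    (hp : ∀ n m, m ≤ N → p n m ∈ jetSpace D v m) (n : ℕ+) {r : ℕ} (hr : n + r ≤ N) :
    D n (η r) ∈ jetSpace D v (n + r) := by
  have hK := K.expand n (n + r) (by have := n.pos; lia)
  rw [if_pos (by lia), Nat.add_sub_cancel_left] at hK
  rw [hK]
  refine add_mem (hp _ _ hr) (sum_mem fun i hi => ?_)
  rw [Finset.mem_Icc] at hi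
  rw [if_pos (by lia)]
  have := mul_mem_weightSpace (K.operator_mem_jetSpace hp n hi.1 hi.2 (by lia))
    (hp (n - i) (n + r - i) (by lia))
  rwa [show i + (n + r - i) = n + r by lia] at this

theorem D_D_mem_jetSpace (K : IsKPExpansion D η p B) (H : IsShift D h)
    (hη : ∀ r, η (r + 1) = -h (r + 1) v) (i j : ℕ+) : D i (D j v) ∈ jetSpace D v (i + j) := by
  suffices ∀ N : ℕ, ∀ i j : ℕ+, (i : ℕ) + j = N → D i (D j v) ∈ jetSpace D v (i + j) from
    this _ i j rfl
  intro N
  induction N using Nat.strong_induction_on with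
  | _ N ih =>
    intro i j hij
    have hN : ∀ i j : ℕ+, (i : ℕ) + j < N → D i (D j v) ∈ jetSpace D v (i + j) :=
      fun i j hij => ih _ hij i j rfl
    have hη_mem : ∀ r, r + 1 ≤ N → D 1 (η r) ∈ jetSpace D v (r + 1) := by
      intro r hr
      cases r with
      | zero => rw [K.eta_zero, map_zero]; exact zero_mem _
      | succ r =>
        rw [hη, map_neg, ← H.apply_D]
        refine neg_mem (H.apply_succ_mem fun k l hkl => ?_)
        have := H.apply_mem_jetSpace hN l (s := k + 1 + 1) (by lia)
          (jet_mem_jetSpace k.succPNat Nat.one_pos)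
        rwa [show r + 1 + 1 = k + 1 + 1 + l by lia]
    have hp : ∀ n m, m ≤ N → p n m ∈ jetSpace D v m :=
      fun n m hm => K.coeff_mem_jetSpace H hη_mem n hm
    obtain ⟨r, rfl⟩ : ∃ r : ℕ, i = r.succPNat := ⟨i.natPred, by simp⟩
    -- `∂_j η_i` is in the space, and it is `i⁻¹ ∂_i ∂_j v` up to elements of the space.
    have h₁ := H.smul_apply_succ_D_add_mem hN j (r := r) (by simp at hij; lia)
    have h₂ := K.D_eta_mem_jetSpace hp j (r := r + 1) (by simp at hij; lia)
    rw [hη, map_neg, ← H.apply_D, neg_mem_iff] at h₂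
    have := (Submodule.add_mem_iff_right _ (Submodule.smul_mem _ ((r : ℚ) + 1) h₂)).1 h₁
    rwa [show ((r.succPNat : ℕ+) : ℕ) + j = j + r + 1 by simp; ring]

theorem eta_sub_mem_jetSpace (K : IsKPExpansion D η p B) (H : IsShift D h)
    (hη : ∀ r, η (r + 1) = -h (r + 1) v) (r : ℕ) :
    η (r + 1) - ((r : ℚ) + 1)⁻¹ • D r.succPNat v ∈ jetSpace D v (r + 1) := by
  have hr : ((r : ℚ) + 1) ≠ 0 := by positivity
  have hDD := K.D_D_mem_jetSpace H hη
  have := H.smul_apply_succ_add_mem (W := jetSpace D v (r + 1)) (r := r) (f := v)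
    fun i j hij => H.apply_succ_mem fun k l hkl => by
      have := H.apply_mem_jetSpace (N := r + 1) (fun i j _ => hDD i j) l (s := k + 1 + (i + 1))
        (by lia) (hDD k.succPNat i.succPNat)
      rwa [show r + 1 = k + 1 + (i + 1) + l by lia]
  rw [← Submodule.smul_mem_iff _ hr, smul_sub, smul_inv_smul₀ hr, hη, smul_neg, ← neg_add']
  exact neg_mem this

end IsKPExpansion
end Hierarchy

/-! ### Chain rule and logarithms of formal power series -/

section ChainRule

open MvPowerSeries.WithPiTopology

variable {σ τ R : Type*} [CommRing R]

theorem continuous_pderiv [TopologicalSpace R] [DiscreteTopology R] (i : σ) :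
    Continuous (MvPowerSeries.pderiv R i : MvPowerSeries σ R → MvPowerSeries σ R) := by
  refine continuous_iff_continuousAt.2 fun f => ?_
  rw [ContinuousAt, tendsto_iff_coeff_tendsto]
  intro d
  simp_rw [MvPowerSeries.coeff_pderiv]
  exact (continuous_of_discreteTopology (f := fun x : R => x * (d i + 1))).tendsto _ |>.comp
    ((continuous_coeff R (d + Finsupp.single i 1)).tendsto f)

/-- The chain rule for substitution into a power series in one variable. -/
theorem pderiv_subst (f : PowerSeries R) {a : MvPowerSeries σ R} (ha : PowerSeries.HasSubst a)
    (i : σ) : MvPowerSeries.pderiv R i (f.subst a) =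
      (PowerSeries.derivative R f).subst a * MvPowerSeries.pderiv R i a := by
  let : UniformSpace R := ⊥
  have hsubst : Continuous (PowerSeries.subst a : PowerSeries R → MvPowerSeries σ R) :=
    MvPowerSeries.continuous_subst ha.const
  refine congrFun (DenseRange.equalizer 
    (denseRange_toMvPowerSeries (σ := Unit) (R := R))
    (g := fun f : PowerSeries R => MvPowerSeries.pderiv R i (f.subst a))
    (h := fun f : PowerSeries R =>
      (PowerSeries.derivative R f).subst a * MvPowerSeries.pderiv R i a)
    ((continuous_pderiv i).comp hsubst)
    ((hsubst.comp (continuous_pderiv ())).mul continuous_const) ?_) f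
  funext p
  simp only [Function.comp_apply]
  induction p using MvPolynomial.induction_on with
  | C r =>
    rw [MvPolynomial.coe_C]
    change MvPowerSeries.pderiv R i ((PowerSeries.C r).subst a) =
      (PowerSeries.derivative R (PowerSeries.C r)).subst a * _
    rw [PowerSeries.subst_C, MvPowerSeries.pderiv_C, PowerSeries.derivative_C,
      ← PowerSeries.coe_substAlgHom ha, map_zero, zero_mul]
  | add p q hp hq =>
    simp only [MvPolynomial.coe_add, PowerSeries.subst_add ha, map_add, hp, hq, add_mul]
  | mul_X p j hp =>
    rw [MvPolynomial.coe_mul, MvPolynomial.coe_X]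
    change MvPowerSeries.pderiv R i (PowerSeries.subst a ((p : PowerSeries R) * PowerSeries.X)) =
      (PowerSeries.derivative R ((p : PowerSeries R) * PowerSeries.X)).subst a * _
    rw [PowerSeries.subst_mul ha, PowerSeries.subst_X ha, Derivation.leibniz, Derivation.leibniz,
      PowerSeries.derivative_X, smul_eq_mul, smul_eq_mul, smul_eq_mul, smul_eq_mul, mul_one,
      PowerSeries.subst_add ha, PowerSeries.subst_mul ha, PowerSeries.subst_X ha, hp]
    ring

end ChainRule

section Log

variable {σ τ : Type}

theorem hasSubst_sub_one {F : MvPowerSeries σ ℂ} (hF : MvPowerSeries.constantCoeff F = 1) :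
    PowerSeries.HasSubst (F - 1) :=
  PowerSeries.HasSubst.of_constantCoeff_zero (by simp [hF])

theorem constantCoeff_logOne {F : MvPowerSeries σ ℂ} (hF : MvPowerSeries.constantCoeff F = 1) :
    MvPowerSeries.constantCoeff (logOne F) = 0 :=
  PowerSeries.constantCoeff_subst_eq_zero (by simp [hF]) _ PowerSeries.constantCoeff_log

theorem one_add_X_mul_derivative_log :
    (1 + PowerSeries.X) * PowerSeries.derivative ℂ (PowerSeries.log ℂ) = 1 := by
  rw [PowerSeries.deriv_log]
  ext n
  rw [add_mul, one_mul, map_add]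
  cases n with
  | zero => simp
  | succ n => simp [PowerSeries.coeff_succ_X_mul, PowerSeries.coeff_one, pow_succ]

/-- The logarithmic derivative; together with the constant term it characterizes `logOne F`. -/
theorem mul_pderiv_logOne {F : MvPowerSeries σ ℂ} (hF : MvPowerSeries.constantCoeff F = 1)
    (i : σ) : F * MvPowerSeries.pderiv ℂ i (logOne F) = MvPowerSeries.pderiv ℂ i F := by
  have hs := hasSubst_sub_one hF
  have h := congrArg (PowerSeries.subst (F - 1)) one_add_X_mul_derivative_log
  rw [PowerSeries.subst_mul hs, PowerSeries.subst_add hs, PowerSeries.subst_X hs,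
    ← PowerSeries.coe_substAlgHom hs, map_one, add_sub_cancel, PowerSeries.coe_substAlgHom hs] at h
  rw [logOne, pderiv_subst _ hs, ← mul_assoc, h, one_mul, map_sub, MvPowerSeries.pderiv_one,
    sub_zero]

theorem logOne_mul {F G : MvPowerSeries σ ℂ} (hF : MvPowerSeries.constantCoeff F = 1)
    (hG : MvPowerSeries.constantCoeff G = 1) : logOne (F * G) = logOne F + logOne G := by
  have hFG : MvPowerSeries.constantCoeff (F * G) = 1 := by simp [hF, hG]
  refine MvPowerSeries.pderiv.ext (fun i => ?_) (by
    simp [constantCoeff_logOne, hF, hG])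
  have h0 : F * G ≠ 0 := by
    intro h
    simp [h] at hFG
  refine mul_left_cancel₀ h0 ?_
  rw [mul_pderiv_logOne hFG, Derivation.leibniz, map_add, smul_eq_mul, smul_eq_mul]
  linear_combination -F * mul_pderiv_logOne hG i - G * mul_pderiv_logOne hF i

theorem subst_logOne {s : σ → MvPowerSeries τ ℂ} (hs : MvPowerSeries.HasSubst s)
    {F : MvPowerSeries σ ℂ} (hF : MvPowerSeries.constantCoeff F = 1) :
    MvPowerSeries.subst s (logOne F) = logOne (MvPowerSeries.subst s F) := by
  rw [logOne, logOne, PowerSeries.subst, MvPowerSeries.subst_comp_subst_apply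
    (hasSubst_sub_one hF).const hs, MvPowerSeries.subst_sub hs]
  congr
  rw [← MvPowerSeries.coe_substAlgHom hs, map_one]

theorem hasSubst_incl :
    MvPowerSeries.HasSubst (fun j : ℕ+ => (MvPowerSeries.X (some j) : FnK)) := by
  classical
  refine ⟨fun j => by simp, fun d => ?_⟩
  refine (d.support.finite_toSet.preimage (Option.some_injective _).injOn).subset fun j hj => ?_
  simp only [Set.mem_ofPred_eq, MvPowerSeries.coeff_X, ne_eq, ite_eq_right_iff,
    Classical.not_imp] at hj
  simp [hj.1]

theorem hasSubst_shift :
    MvPowerSeries.HasSubst (fun j : ℕ+ =>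
    (MvPowerSeries.X (some j) -
      MvPowerSeries.C ((j : ℂ)⁻¹) * MvPowerSeries.X none ^ (j : ℕ) : FnK)) := by
  classical
  have h : MvPowerSeries.HasSubst (fun j : ℕ+ => (MvPowerSeries.X none ^ (j : ℕ) : FnK)) := by
    refine ⟨fun j => by simp [zero_pow], fun d => ?_⟩
    refine (Set.finite_le_nat (d none)).preimage PNat.coe_injective.injOn |>.subset fun j hj => ?_
    simp only [Set.mem_ofPred_eq, MvPowerSeries.coeff_X_pow, ne_eq, ite_eq_right_iff,
      Classical.not_imp] at hj
    simp [hj.1]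
  have h₂ := hasSubst_incl.add (h.mul_left fun j : ℕ+ => (-MvPowerSeries.C ((j : ℂ)⁻¹) : FnK))
  convert h₂ using 2
  simp [sub_eq_add_neg]

theorem constantCoeff_one_add_genSeries (a : ℕ+ → Fn) :
    MvPowerSeries.constantCoeff (1 + genSeries a) = 1 := by
  rw [map_add, map_one, add_eq_left]
  change MvPowerSeries.coeff 0 (genSeries a) = 0
  simp [genSeries, MvPowerSeries.coeff_apply]

/-- The logarithm of the defining equation of a tau function: the constants `c` in `ln τ` cancel, so
that the choice of the branch does not matter. -/
theorem logOne_one_add_genSeries {ξ : ℕ+ → Fn} {τ v : Fn} (hτ : IsTauFunction ξ τ)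
    (hv : IsLog (-v) τ) : logOne (1 + genSeries ξ) = incl v - shift v := by
  obtain ⟨c, hc, hv⟩ := hv
  -- Normalize `τ` to have constant term `1`, where `logOne` is the logarithm.
  set τ' : Fn := MvPowerSeries.C (Complex.exp (-c)) * τ with hτ'
  have h_const : MvPowerSeries.constantCoeff τ' = 1 := by
    rw [hτ', map_mul, MvPowerSeries.constantCoeff_C, ← hc, ← Complex.exp_add]
    simp
  have hmul : (1 + genSeries ξ) * incl τ' = shift τ' := by
    rw [IsTauFunction] at hτ
    rw [hτ', incl, shift, MvPowerSeries.subst_mul hasSubst_incl,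
      MvPowerSeries.subst_mul hasSubst_shift, MvPowerSeries.subst_C, MvPowerSeries.subst_C,
      mul_left_comm]
    exact congrArg _ hτ
  have hincl : MvPowerSeries.constantCoeff (incl τ') = 1 := by
    have := MvPowerSeries.constantCoeff_subst_eq_zero hasSubst_incl (by simp) (f := τ' - 1)
      (by simp [h_const])
    rw [← MvPowerSeries.coe_substAlgHom hasSubst_incl, map_sub, map_one, map_sub, map_one,
      sub_eq_zero] at this
    rwa [incl, ← MvPowerSeries.coe_substAlgHom hasSubst_incl]
  have hlog := logOne_mul (constantCoeff_one_add_genSeries ξ) hincl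
  have hv' : logOne τ' = -v - MvPowerSeries.C c := by rw [hv]; ring
  rw [hmul, shift, incl, ← subst_logOne hasSubst_shift h_const,
    ← subst_logOne hasSubst_incl h_const, hv', ← MvPowerSeries.coe_substAlgHom hasSubst_incl,
    ← MvPowerSeries.coe_substAlgHom hasSubst_shift, map_sub, map_sub, map_neg, map_neg,
    MvPowerSeries.coe_substAlgHom hasSubst_incl, MvPowerSeries.coe_substAlgHom hasSubst_shift,
    MvPowerSeries.subst_C, MvPowerSeries.subst_C] at hlog
  rw [incl, shift]
  linear_combination -hlog

end Log

/-! ### The shifted function as a power series in `κ` -/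

section Shift

open MvPowerSeries.WithPiTopology

/-- The ring isomorphism `ℂ⟦k⁻¹, x⟧ ≃ ℂ⟦x⟧⟦k⁻¹⟧`. -/
abbrev expandK : FnK ≃ₐ[ℂ] PowerSeries Fn := MvPowerSeries.optionEquivLeft ℕ+ ℂ

theorem coeff_kCoeff (r : ℕ) (F : FnK) (a : ℕ+ →₀ ℕ) :
    MvPowerSeries.coeff a (kCoeff r F) = MvPowerSeries.coeff (a.optionElim r) F := rfl

theorem coeff_expandK (r : ℕ) (F : FnK) : PowerSeries.coeff r (expandK F) = kCoeff r F := by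
  ext a
  rw [MvPowerSeries.coeff_coeff_optionEquivLeft, coeff_kCoeff]

/-- The homomorphism `f(x) ↦ f(x₁ - κ, x₂ - κ²/2, …)` with values in the power series in `κ`. -/
def shiftHom : Fn →ₐ[ℂ] PowerSeries Fn :=
  (expandK : FnK →ₐ[ℂ] PowerSeries Fn).comp (MvPowerSeries.substAlgHom hasSubst_shift)

theorem coeff_shiftHom (r : ℕ) (f : Fn) :
    PowerSeries.coeff r (shiftHom f) = kCoeff r (shift f) := by
  rw [← coeff_expandK, shift, ← MvPowerSeries.coe_substAlgHom hasSubst_shift]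
  rfl

theorem shiftHom_X (j : ℕ+) : shiftHom (MvPowerSeries.X j) =
    PowerSeries.C (MvPowerSeries.X j) -
      PowerSeries.C (MvPowerSeries.C ((j : ℂ)⁻¹)) * PowerSeries.X ^ (j : ℕ) := by
  change expandK (MvPowerSeries.substAlgHom hasSubst_shift (MvPowerSeries.X j)) = _
  rw [MvPowerSeries.substAlgHom_X, map_sub, map_mul, map_pow,
    MvPowerSeries.optionEquivLeft_X_some, MvPowerSeries.optionEquivLeft_C,
    MvPowerSeries.optionEquivLeft_X_none]

theorem shiftHom_C (c : ℂ) :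
    shiftHom (MvPowerSeries.C c) = PowerSeries.C (MvPowerSeries.C c) := by
  change expandK (MvPowerSeries.substAlgHom hasSubst_shift (MvPowerSeries.C c)) = _
  rw [MvPowerSeries.coe_substAlgHom, MvPowerSeries.subst_C, MvPowerSeries.optionEquivLeft_C]

/-- Two maps that are continuous for the product topology over the discrete field `ℂ` agree if they
agree on polynomials. The topology is spelled out because it is not the one induced by the usual
topology of `ℂ`. -/
theorem funext_of_mvPolynomial {φ ψ : Fn → Fn}
    (hφ : @Continuous Fn Fn (@instTopologicalSpace ℕ+ ℂ ⊥) (@instTopologicalSpace ℕ+ ℂ ⊥) φ)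
    (hψ : @Continuous Fn Fn (@instTopologicalSpace ℕ+ ℂ ⊥) (@instTopologicalSpace ℕ+ ℂ ⊥) ψ)
    (h : ∀ P : MvPolynomial ℕ+ ℂ, φ P = ψ P) (f : Fn) : φ f = ψ f := by
  let : TopologicalSpace ℂ := ⊥
  have : DiscreteTopology ℂ := ⟨rfl⟩
  exact congrFun (DenseRange.equalizer
    (denseRange_toMvPowerSeries (σ := ℕ+) (R := ℂ)) hφ hψ (funext h)) f

theorem continuous_kCoeff_shift (r : ℕ) :
    @Continuous Fn Fn (@instTopologicalSpace ℕ+ ℂ ⊥) (@instTopologicalSpace ℕ+ ℂ ⊥)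
      fun f => kCoeff r (shift f) := by
  let : UniformSpace ℂ := ⊥
  let : TopologicalSpace ℂ := ⊥
  have hshift : Continuous shift := MvPowerSeries.continuous_subst hasSubst_shift
  refine continuous_iff_continuousAt.2 fun f => ?_
  rw [ContinuousAt, tendsto_iff_coeff_tendsto]
  intro d
  simp_rw [coeff_kCoeff]
  exact ((continuous_coeff ℂ (d.optionElim r)).comp hshift).tendsto f

theorem kCoeff_zero_shift (f : Fn) : kCoeff 0 (shift f) = f := by
  let : UniformSpace ℂ := ⊥
  let : TopologicalSpace ℂ := ⊥
  refine funext_of_mvPolynomial (φ := fun f => kCoeff 0 (shift f)) (ψ := id)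
    (continuous_kCoeff_shift 0) continuous_id (fun P => ?_) f
  rw [id, ← coeff_shiftHom, PowerSeries.coeff_zero_eq_constantCoeff_apply]
  induction P using MvPolynomial.induction_on with
  | C c => simp [shiftHom_C]
  | add P Q hP hQ => rw [MvPolynomial.coe_add, map_add, map_add, hP, hQ]
  | mul_X P j hP =>
    rw [MvPolynomial.coe_mul, MvPolynomial.coe_X, map_mul, map_mul, hP, shiftHom_X]
    simp

/-- The chain rule for `d/dκ f(x₁ - κ, x₂ - κ²/2, …)` for polynomials `f`. Modulo `κᴹ` the sum over
all variables is finite, and both sides are derivations, which need to be compared on variables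
only. -/
theorem X_pow_dvd_derivative_shiftHom (M : ℕ) (P : MvPolynomial ℕ+ ℂ) :
    (PowerSeries.X : PowerSeries Fn) ^ M ∣
      PowerSeries.derivative Fn (shiftHom P) +
        ∑ i ∈ Finset.range M, PowerSeries.X ^ i * shiftHom (D i.succPNat P) := by
  induction P using MvPolynomial.induction_on with
  | C c =>
    simp [shiftHom_C, D]
  | add P Q hP hQ =>
    convert dvd_add hP hQ using 1
    simp only [MvPolynomial.coe_add, map_add, mul_add, Finset.sum_add_distrib]
    ring
  | mul_X P j hP =>
    have hX : (PowerSeries.X : PowerSeries Fn) ^ M ∣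
        PowerSeries.derivative Fn (shiftHom (MvPowerSeries.X j)) +
        ∑ i ∈ Finset.range M, PowerSeries.X ^ i * shiftHom (D i.succPNat (MvPowerSeries.X j)) := by
      obtain ⟨j, rfl⟩ : ∃ i : ℕ, j = i.succPNat := ⟨j.natPred, by simp⟩
      have hsum : ∑ i ∈ Finset.range M, PowerSeries.X ^ i *
            shiftHom (D i.succPNat (MvPowerSeries.X j.succPNat)) =
          if j < M then PowerSeries.X ^ j else 0 := by
        have (i : ℕ) : PowerSeries.X ^ i * shiftHom (D i.succPNat (MvPowerSeries.X j.succPNat)) =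
            if i = j then PowerSeries.X ^ i else 0 := by
          rw [D, MvPowerSeries.pderiv_X]
          by_cases h : i = j
          · simp [h]
          · simp [h, Nat.succPNat_inj]
        simp [this]
      have hder : PowerSeries.derivative Fn (shiftHom (MvPowerSeries.X j.succPNat)) =
          -PowerSeries.X ^ j := by
        have hj_ne : ((j : ℂ) + 1) ≠ 0 := Nat.cast_add_one_ne_zero j
        rw [shiftHom_X, map_sub, PowerSeries.derivative_C, zero_sub, Derivation.leibniz]
        simp
        have hj : ((j : PowerSeries Fn) + 1) =
            PowerSeries.C (MvPowerSeries.C ((j : ℂ) + 1)) := by simp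
        rw [hj, ← mul_assoc, ← map_mul, ← map_mul, inv_mul_cancel₀ hj_ne, map_one, map_one, one_mul]
      rw [hsum, hder]
      split_ifs with h
      · simp
      · rw [add_zero, dvd_neg]
        exact pow_dvd_pow _ (not_lt.1 h)
    convert dvd_add (hP.mul_left (shiftHom (MvPowerSeries.X j))) (hX.mul_left (shiftHom P)) using 1
    simp only [MvPolynomial.coe_mul, MvPolynomial.coe_X, map_mul, Derivation.leibniz, smul_eq_mul,
      map_add, mul_add, Finset.sum_add_distrib, Finset.mul_sum, D]
    ring_nf

/-- Newton's recursion: the coefficient of `κʳ` in the chain rule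
`∂/∂κ f(x₁ - κ, x₂ - κ²/2, …) = -∑_{i ≥ 0} κⁱ (∂_{i+1} f)(x₁ - κ, x₂ - κ²/2, …)`. -/
theorem succ_smul_kCoeff_shift (r : ℕ) (f : Fn) :
    ((r : ℂ) + 1) • kCoeff (r + 1) (shift f) =
      -∑ p ∈ Finset.HasAntidiagonal.antidiagonal r, kCoeff p.2 (shift (D p.1.succPNat f)) := by
  let : UniformSpace ℂ := ⊥
  let : TopologicalSpace ℂ := ⊥
  have : DiscreteTopology ℂ := ⟨rfl⟩
  have : IsTopologicalRing ℂ := inferInstance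
  refine funext_of_mvPolynomial (φ := fun f => ((r : ℂ) + 1) • kCoeff (r + 1) (shift f))
    (ψ := fun f =>
      -∑ p ∈ Finset.HasAntidiagonal.antidiagonal r, kCoeff p.2 (shift (D p.1.succPNat f)))
    ?_ ?_ (fun P => ?_) f
  · simp_rw [MvPowerSeries.smul_eq_C_mul]
    exact continuous_const.mul (continuous_kCoeff_shift (r + 1))
  · exact (continuous_finsetSum _ fun p _ =>
      (continuous_kCoeff_shift p.2).comp (continuous_pderiv p.1.succPNat)).neg
  · have h := PowerSeries.X_pow_dvd_iff.1 (X_pow_dvd_derivative_shiftHom (r + 1) P) r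
      r.lt_succ_self
    rw [map_add, PowerSeries.coeff_derivative, coeff_shiftHom, map_sum] at h
    rw [Finset.Nat.sum_antidiagonal_eq_sum_range_succ_mk, ← add_eq_zero_iff_eq_neg, ← h]
    congr 1
    · rw [MvPowerSeries.smul_eq_C_mul]
      simp [mul_comm]
    · refine Finset.sum_congr rfl fun i hi => ?_
      rw [PowerSeries.coeff_X_pow_mul', if_pos (Nat.lt_succ_iff.1 (Finset.mem_range.1 hi)),
        coeff_shiftHom]

end Shift

/-! ### The ring of wave functions -/

section WaveFunction

theorem coeff_toWaveFn (F : FnK) (a : ℕ+ →₀ ℕ) :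
    MvPowerSeries.coeff a (toWaveFn F) = HahnSeries.ofPowerSeries ℤ ℂ
      (PowerSeries.mk fun i => MvPowerSeries.coeff a (kCoeff i F)) := rfl

theorem kCoeff_add (r : ℕ) (F G : FnK) : kCoeff r (F + G) = kCoeff r F + kCoeff r G := by
  simp only [← coeff_expandK, map_add]

theorem kCoeff_mul (r : ℕ) (F G : FnK) : kCoeff r (F * G) =
    ∑ p ∈ Finset.HasAntidiagonal.antidiagonal r, kCoeff p.1 F * kCoeff p.2 G := by
  simp only [← coeff_expandK, map_mul, PowerSeries.coeff_mul]

theorem kCoeff_one (r : ℕ) : kCoeff r 1 = if r = 0 then 1 else 0 := by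
  rw [← coeff_expandK, map_one, PowerSeries.coeff_one]

theorem kCoeff_X_pow_mul (i r : ℕ) (F : FnK) :
    kCoeff r (MvPowerSeries.X none ^ i * F) = if i ≤ r then kCoeff (r - i) F else 0 := by
  simp only [← coeff_expandK, map_mul, map_pow, MvPowerSeries.optionEquivLeft_X_none,
    PowerSeries.coeff_X_pow_mul']

theorem kCoeff_incl (r : ℕ) (f : Fn) : kCoeff r (incl f) = if r = 0 then f else 0 := by
  have h : incl f = MvPowerSeries.rename (Function.Embedding.some : ℕ+ ↪ Option ℕ+) f :=
    (MvPowerSeries.rename_eq_subst (f := Function.Embedding.some) f).symm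
  ext a
  rw [coeff_kCoeff, h]
  split_ifs with hr
  · subst hr
    rw [← MvPowerSeries.coeff_embDomain_rename Function.Embedding.some f a]
    congr
    ext j
    cases j with
    | none =>
      rw [Finsupp.embDomain_of_notMem_range _ _ _ (by simp)]
      simp
    | some j =>
      rw [Finsupp.optionElim_apply_some]
      exact (Finsupp.embDomain_apply_self Function.Embedding.some a j).symm
  · rw [map_zero]
    refine MvPowerSeries.coeff_rename_eq_zero _ _ ?_
    rintro ⟨b, hb⟩
    refine hr ?_
    have := DFunLike.congr_fun hb none
    rw [Finsupp.optionElim_apply_none] at this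
    rw [← this]
    exact Finsupp.mapDomain_of_notMem_range _ _ (by simp)

theorem expandK_incl (f : Fn) : expandK (incl f) = PowerSeries.C f := by
  ext1 r
  rw [coeff_expandK, kCoeff_incl, PowerSeries.coeff_C]

theorem kCoeff_pderiv (n : ℕ+) (r : ℕ) (F : FnK) :
    kCoeff r (MvPowerSeries.pderiv ℂ (some n) F) = D n (kCoeff r F) := by
  ext a
  rw [D, MvPowerSeries.coeff_pderiv, coeff_kCoeff, coeff_kCoeff, MvPowerSeries.coeff_pderiv]
  have : (a + Finsupp.single n 1).optionElim r =
      a.optionElim r + Finsupp.single (some n) 1 := by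
    ext j
    cases j <;> simp [Finsupp.single_apply]
  rw [this, Finsupp.optionElim_apply_some]

theorem toWaveFn_add (F G : FnK) : toWaveFn (F + G) = toWaveFn F + toWaveFn G := by
  ext1 a
  rw [map_add, coeff_toWaveFn, coeff_toWaveFn, coeff_toWaveFn, ← map_add]
  congr 1

theorem toWaveFn_mul (F G : FnK) : toWaveFn (F * G) = toWaveFn F * toWaveFn G := by
  classical
  ext1 a
  rw [MvPowerSeries.coeff_mul]
  simp_rw [coeff_toWaveFn, ← map_mul, ← map_sum]
  congr 1
  ext r
  simp_rw [PowerSeries.coeff_mk, map_sum, PowerSeries.coeff_mul, PowerSeries.coeff_mk, kCoeff_mul,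
    map_sum, MvPowerSeries.coeff_mul]
  exact Finset.sum_comm

theorem toWaveFn_one : toWaveFn 1 = 1 := by
  classical
  ext1 a
  rw [coeff_toWaveFn, MvPowerSeries.coeff_one]
  have : (PowerSeries.mk fun i => MvPowerSeries.coeff a (kCoeff i 1)) =
      if a = 0 then (1 : PowerSeries ℂ) else 0 := by
    ext i
    rw [PowerSeries.coeff_mk, kCoeff_one]
    split_ifs with hi ha ha <;> simp [hi, ha, MvPowerSeries.coeff_one, PowerSeries.coeff_one]
  rw [this]
  split_ifs <;> simp

/-- The inclusion `ℂ⟦k⁻¹, x⟧ ⊆ ℂ((k⁻¹))⟦x⟧` as a ring homomorphism. -/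
def toWaveFnHom : FnK →+* WaveFn :=
  RingHom.mk' ⟨⟨toWaveFn, toWaveFn_one⟩, toWaveFn_mul⟩ toWaveFn_add

theorem toWaveFnHom_apply (F : FnK) : toWaveFnHom F = toWaveFn F := rfl

theorem toWaveFnHom_injective : Function.Injective toWaveFnHom := by
  intro F G h
  refine expandK.injective ?_
  ext r a
  have := congrArg (MvPowerSeries.coeff a) h
  rw [toWaveFnHom_apply, toWaveFnHom_apply, coeff_toWaveFn, coeff_toWaveFn] at this
  have := congrArg (PowerSeries.coeff r) (HahnSeries.ofPowerSeries_injective this)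
  rwa [PowerSeries.coeff_mk, PowerSeries.coeff_mk, ← coeff_expandK, ← coeff_expandK] at this

theorem DW_toWaveFnHom (n : ℕ+) (F : FnK) :
    DW n (toWaveFnHom F) = toWaveFnHom (MvPowerSeries.pderiv ℂ (some n) F) := by
  ext1 a
  rw [DW, MvPowerSeries.coeff_pderiv, toWaveFnHom_apply, toWaveFnHom_apply, coeff_toWaveFn,
    coeff_toWaveFn]
  have : ((a n : LaurentSeries ℂ) + 1) =
      HahnSeries.ofPowerSeries ℤ ℂ (PowerSeries.C ((a n : ℂ) + 1)) := by simp
  rw [this, ← map_mul]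
  congr 1
  ext i
  rw [PowerSeries.coeff_mul_C, PowerSeries.coeff_mk, PowerSeries.coeff_mk, kCoeff_pderiv, D,
    MvPowerSeries.coeff_pderiv]

/-- The function `kᵐ`, which is not in `ℂ⟦k⁻¹, x⟧` for `m > 0`. -/
def kPow (m : ℕ) : WaveFn := MvPowerSeries.C (HahnSeries.single (-(m : ℤ)) 1)

theorem kPow_add (m n : ℕ) : kPow (m + n) = kPow m * kPow n := by
  rw [kPow, kPow, kPow, ← map_mul, HahnSeries.single_mul_single]
  congr 2
  · rw [Nat.cast_add, neg_add]
  · simp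

theorem DW_kPow_mul (n : ℕ+) (m : ℕ) (F : WaveFn) : DW n (kPow m * F) = kPow m * DW n F := by
  rw [DW, Derivation.leibniz, kPow, MvPowerSeries.pderiv_C]
  simp

theorem ofFn_eq (f : Fn) : ofFn f = toWaveFnHom (incl f) := by
  ext1 a
  rw [toWaveFnHom_apply, coeff_toWaveFn, ofFn, MvPowerSeries.coeff_map,
    ← HahnSeries.ofPowerSeries_C]
  congr 1
  ext i
  rw [PowerSeries.coeff_mk, kCoeff_incl, PowerSeries.coeff_C]
  split_ifs <;> simp

theorem kPow_mul_X_pow (m : ℕ) : kPow m * toWaveFnHom (MvPowerSeries.X none ^ m) = 1 := by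
  classical
  have : toWaveFnHom (MvPowerSeries.X none ^ m) = MvPowerSeries.C (HahnSeries.single (m : ℤ) 1) := by
    ext1 a
    rw [toWaveFnHom_apply, coeff_toWaveFn, MvPowerSeries.coeff_C]
    have : (PowerSeries.mk fun i => MvPowerSeries.coeff a (kCoeff i (MvPowerSeries.X none ^ m))) =
        if a = 0 then (PowerSeries.X ^ m : PowerSeries ℂ) else 0 := by
      ext i
      have := kCoeff_X_pow_mul m i 1
      rw [mul_one, kCoeff_one] at this
      rw [PowerSeries.coeff_mk, this]
      by_cases ha : a = 0
      · subst ha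
        rw [if_pos rfl, PowerSeries.coeff_X_pow]
        by_cases him : i = m
        · simp [him]
        · rw [if_neg him]
          split_ifs <;> first | rfl | lia
      · rw [if_neg ha]
        split_ifs <;> simp [MvPowerSeries.coeff_one, ha]
    rw [this]
    split_ifs
    · rw [HahnSeries.ofPowerSeries_X_pow]
    · simp
  rw [this, kPow, ← map_mul, HahnSeries.single_mul_single]
  simp

theorem DW_planeWave (n : ℕ+) : DW n planeWave = kPow n * planeWave := by
  classical
  ext1 a
  rw [DW, MvPowerSeries.coeff_pderiv, kPow, MvPowerSeries.coeff_C_mul]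
  change HahnSeries.single _ _ * _ = _ * HahnSeries.single _ _
  rw [HahnSeries.single_mul_single]
  have h_nat : ((a n : LaurentSeries ℂ) + 1) = HahnSeries.single 0 ((a n : ℂ) + 1) := by
    rw [← Nat.cast_add_one, ← Nat.cast_add_one]
    exact (map_natCast (HahnSeries.C : ℂ →+* LaurentSeries ℂ) _).symm
  rw [h_nat, HahnSeries.single_mul_single]
  congr 1
  · rw [Finsupp.sum_add_index' (by simp) (by intros; push_cast; exact mul_add _ _ _)]
    simp
  · have he : (a + Finsupp.single n 1).erase n = a.erase n := by
      ext j
      by_cases hj : j = n <;> simp [hj, Finsupp.erase_ne]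
    rw [← Finsupp.mul_prod_erase' a n _ (by simp),
      ← Finsupp.mul_prod_erase' (a + Finsupp.single n 1) n _ (by simp), he]
    have hn : ((a n : ℂ) + 1) ≠ 0 := Nat.cast_add_one_ne_zero _
    simp [Nat.factorial_succ]
    field_simp

end WaveFunction

/-! ### The KP equations -/

section Hierarchy

theorem waveFunction_ne_zero (ξ : ℕ+ → Fn) : waveFunction ξ ≠ 0 := by
  refine mul_ne_zero (fun h => ?_) (fun h => ?_)
  · have := congrArg (MvPowerSeries.coeff 0) h
    change HahnSeries.single _ _ = _ at this
    simp at this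
  · have h₁ : 1 + genSeries ξ = 0 := toWaveFnHom_injective (h.trans (map_zero _).symm)
    have := constantCoeff_one_add_genSeries ξ
    simp [h₁] at this

theorem DW_waveFunction (ξ : ℕ+ → Fn) (n : ℕ+) : DW n (waveFunction ξ) =
    waveFunction ξ *
      (kPow n + toWaveFnHom (MvPowerSeries.pderiv ℂ (some n) (logOne (1 + genSeries ξ)))) := by
  have h := mul_pderiv_logOne (constantCoeff_one_add_genSeries ξ) (some n)
  change DW n (planeWave * toWaveFnHom (1 + genSeries ξ)) =
    planeWave * toWaveFnHom (1 + genSeries ξ) * _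
  rw [DW, Derivation.leibniz, smul_eq_mul, smul_eq_mul]
  change _ * DW n (toWaveFnHom (1 + genSeries ξ)) + _ * DW n planeWave = _
  rw [DW_toWaveFnHom, ← h, DW_planeWave, map_mul]
  ring

/-- The series `κⁿ (∂₁ⁿ ψ) / ψ` in `κ = k⁻¹`, defined by the recursion that follows from
`∂₁ ψ = ψ (k + ∂₁ ln (1 + ∑ ξ_i κⁱ))`. -/
def waveQuotient (ξ : ℕ+ → Fn) : ℕ → FnK
  | 0 => 1
  | n + 1 => waveQuotient ξ n + MvPowerSeries.X none ^ 1 *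
      (MvPowerSeries.pderiv ℂ (some 1) (waveQuotient ξ n) +
        waveQuotient ξ n * MvPowerSeries.pderiv ℂ (some 1) (logOne (1 + genSeries ξ)))

theorem iterate_DW_waveFunction (ξ : ℕ+ → Fn) (n : ℕ) :
    (DW 1)^[n] (waveFunction ξ) =
      waveFunction ξ * (kPow n * toWaveFnHom (waveQuotient ξ n)) := by
  induction n with
  | zero => simp [waveQuotient, kPow]
  | succ n ih =>
    have h := kPow_mul_X_pow 1
    rw [Function.iterate_succ_apply', ih, DW, Derivation.leibniz, smul_eq_mul, smul_eq_mul]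
    change _ * DW 1 _ + _ * DW 1 _ = _
    rw [DW_kPow_mul, DW_toWaveFnHom, DW_waveFunction, waveQuotient, kPow_add, map_add, map_mul,
      map_add, map_mul, PNat.one_coe]
    linear_combination (-waveFunction ξ * kPow n *
      (toWaveFnHom (MvPowerSeries.pderiv ℂ (some 1) (waveQuotient ξ n)) +
        toWaveFnHom (waveQuotient ξ n) *
          toWaveFnHom (MvPowerSeries.pderiv ℂ (some 1) (logOne (1 + genSeries ξ))))) * h

/-- The KP equation divided by `kⁿ ψ`, as an identity between power series in `k⁻¹`. -/
theorem expansion_of_kp {ξ : ℕ+ → Fn} {n : ℕ+} {B : ℕ → Fn}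
    (hB : DW n (waveFunction ξ) = (DW 1)^[n] (waveFunction ξ) +
        ∑ i ∈ Finset.Icc 2 (n : ℕ), ofFn (B i) * (DW 1)^[n - i] (waveFunction ξ)) :
    1 + MvPowerSeries.X none ^ (n : ℕ) *
        MvPowerSeries.pderiv ℂ (some n) (logOne (1 + genSeries ξ)) =
      waveQuotient ξ n + ∑ i ∈ Finset.Icc 2 (n : ℕ),
        incl (B i) * (MvPowerSeries.X none ^ i * waveQuotient ξ (n - i)) := by
  refine toWaveFnHom_injective (mul_left_cancel₀ (waveFunction_ne_zero ξ) ?_)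
  have hn := kPow_mul_X_pow n
  have h₁ : ∑ i ∈ Finset.Icc 2 (n : ℕ), ofFn (B i) * (DW 1)^[n - i] (waveFunction ξ) =
      waveFunction ξ * (kPow n * toWaveFnHom (∑ i ∈ Finset.Icc 2 (n : ℕ),
        incl (B i) * (MvPowerSeries.X none ^ i * waveQuotient ξ (n - i)))) := by
    rw [map_sum, Finset.mul_sum, Finset.mul_sum]
    refine Finset.sum_congr rfl fun i hi => ?_
    have hk : kPow n = kPow (n - i) * kPow i := by
      rw [← kPow_add, Nat.sub_add_cancel (Finset.mem_Icc.1 hi).2]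
    rw [iterate_DW_waveFunction, ofFn_eq, map_mul, map_mul, hk]
    linear_combination (-waveFunction ξ * kPow (n - i) * toWaveFnHom (incl (B i)) *
      toWaveFnHom (waveQuotient ξ (n - i))) * kPow_mul_X_pow i
  rw [h₁, DW_waveFunction, iterate_DW_waveFunction] at hB
  rw [map_add, map_one, map_mul, map_add]
  linear_combination toWaveFnHom (MvPowerSeries.X none ^ (n : ℕ)) * hB + waveFunction ξ *
    (toWaveFnHom (waveQuotient ξ n) + toWaveFnHom (∑ i ∈ Finset.Icc 2 (n : ℕ),
        incl (B i) * (MvPowerSeries.X none ^ i * waveQuotient ξ (n - i))) - 1) * hn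

theorem kCoeff_zero_logOne {ξ : ℕ+ → Fn} {τ v : Fn} (hτ : IsTauFunction ξ τ)
    (hv : IsLog (-v) τ) : kCoeff 0 (logOne (1 + genSeries ξ)) = 0 := by
  rw [logOne_one_add_genSeries hτ hv, ← coeff_expandK, map_sub, map_sub, coeff_expandK,
    coeff_expandK, kCoeff_incl, kCoeff_zero_shift, if_pos rfl, sub_self]

theorem kCoeff_succ_logOne {ξ : ℕ+ → Fn} {τ v : Fn} (hτ : IsTauFunction ξ τ)
    (hv : IsLog (-v) τ) (r : ℕ) :
    kCoeff (r + 1) (logOne (1 + genSeries ξ)) = -kCoeff (r + 1) (shift v) := by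
  rw [logOne_one_add_genSeries hτ hv, ← coeff_expandK, map_sub, map_sub, coeff_expandK,
    coeff_expandK, kCoeff_incl, if_neg r.succ_ne_zero, zero_sub]

end Hierarchy

section Universal

/-- The solutions of the KP hierarchy together with a tau function and minus its logarithm. -/
def Solution : Type :=
  {s : (ℕ+ → Fn) × Fn × Fn // IsKPSolution s.1 ∧ IsTauFunction s.1 s.2.1 ∧ IsLog (-s.2.2) s.2.1}

/-- The derivation `∂_j` on families of functions indexed by the solutions. -/
def DFamily (j : ℕ+) : Derivation ℚ (Solution → Fn) (Solution → Fn) :=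
  Derivation.mk'
    { toFun := fun f s => D j (f s)
      map_add' := fun _ _ => funext fun _ => map_add _ _ _
      map_smul' := fun c f => funext fun s =>
        ((MvPowerSeries.pderiv ℂ j).restrictScalars ℚ).map_smul c (f s) }
    fun f g => funext fun s => (MvPowerSeries.pderiv ℂ j).leibniz (f s) (g s)

theorem DFamily_apply (j : ℕ+) (f : Solution → Fn) (s : Solution) : DFamily j f s = D j (f s) :=
  rfl

theorem isShift_family :
    IsShift DFamily fun r (f : Solution → Fn) s => kCoeff r (shift (f s)) where
  comm i j f := by
    classical
    ext s a
    simp only [DFamily_apply, D, MvPowerSeries.coeff_pderiv, Finsupp.add_apply,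
      add_right_comm a]
    by_cases hij : i = j
    · subst hij; rfl
    · simp [hij, Ne.symm hij]
      ring
  zero f := funext fun s => kCoeff_zero_shift (f s)
  succ r f := by
    ext1 s
    have := succ_smul_kCoeff_shift r (f s)
    simp only [Pi.smul_apply, Pi.neg_apply, Finset.sum_apply, DFamily_apply]
    rw [← this, ← Rat.cast_smul_eq_qsmul ℂ]
    simp

theorem iterate_DFamily_apply (j : ℕ+) (t : ℕ) (f : Solution → Fn) (s : Solution) :
    (DFamily j)^[t] f s = (D j)^[t] (f s) := by
  induction t with
  | zero => rfl
  | succ t ih => rw [Function.iterate_succ_apply', Function.iterate_succ_apply', DFamily_apply, ih]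

theorem aeval_jet_apply (P : MvPolynomial (ℕ+ × ℕ+) ℚ) (f : Solution → Fn) (s : Solution) :
    MvPolynomial.aeval (jet DFamily f) P s = evalAt (f s) P := by
  change (Pi.evalAlgHom ℚ (fun _ : Solution => Fn) s).comp (MvPolynomial.aeval (jet DFamily f)) P =
    _
  rw [evalAt]
  congr 1
  refine MvPolynomial.algHom_ext fun p => ?_
  simp [jet, DFamily_apply, iterate_DFamily_apply]

theorem exists_isKPExpansion_family : ∃ B, IsKPExpansion DFamily
    (fun r (s : Solution) => kCoeff r (logOne (1 + genSeries s.1.1)))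
    (fun n m s => kCoeff m (waveQuotient s.1.1 n)) B := by
  choose B hB using fun s : Solution => s.2.1
  refine ⟨fun n i s => B s n i, ?_, ?_, ?_, ?_, ?_, ?_⟩
  · exact funext fun s => kCoeff_zero_logOne s.2.2.1 s.2.2.2
  · ext1 s
    rw [waveQuotient, kCoeff_one]
    simp
  · intro m
    ext1 s
    rw [waveQuotient, kCoeff_one]
    simp
  · intro n
    ext1 s
    rw [waveQuotient, kCoeff_add, kCoeff_X_pow_mul]
    simp
  · intro n m
    ext1 s
    rw [waveQuotient, kCoeff_add, kCoeff_X_pow_mul, if_pos (by lia), Nat.add_sub_cancel, kCoeff_add,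
      kCoeff_mul]
    simp only [Pi.add_apply, Finset.sum_apply, Pi.mul_apply, DFamily_apply, kCoeff_pderiv,
      add_assoc]
  · intro n m hm
    ext1 s
    have h := congrArg (fun F => PowerSeries.coeff m (expandK F)) (expansion_of_kp (hB s n))
    simp only [map_add, map_sum, map_mul, expandK_incl, PowerSeries.coeff_C_mul] at h
    simp only [← map_mul, coeff_expandK, kCoeff_X_pow_mul, kCoeff_pderiv, kCoeff_one,
      if_neg hm.ne', zero_add] at h
    simp only [Pi.add_apply, Finset.sum_apply]
    convert h using 2
    · split_ifs <;> rfl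
    · refine Finset.sum_congr rfl fun i _ => ?_
      split_ifs
      · rfl
      · rw [mul_zero]; rfl

end Universal
end KP

end

theorem theorem4p1 :
    ∃ (R : ℕ+ → MvPolynomial (ℕ+ × ℕ+) ℚ) (S : ℕ+ → ℕ+ → MvPolynomial (ℕ+ × ℕ+) ℚ),
      (∀ r : ℕ+, (R r).IsWeightedHomogeneous KP.wt (r : ℕ)) ∧
      (∀ i j : ℕ+, (S i j).IsWeightedHomogeneous KP.wt ((i : ℕ) + (j : ℕ))) ∧
      ∀ (ξ : ℕ+ → KP.Fn) (τ v : KP.Fn),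
        KP.IsKPSolution ξ → KP.IsTauFunction ξ τ → KP.IsLog (-v) τ →
          (∀ r : ℕ+, KP.eta ξ r = ((r : ℂ)⁻¹) • KP.D r v + KP.evalAt v (R r)) ∧
          (∀ i j : ℕ+, KP.D i (KP.D j v) = KP.evalAt v (S i j)) := by
  obtain ⟨B, K⟩ := KP.exists_isKPExpansion_family
  have hη (r : ℕ) : (fun s : KP.Solution =>
      KP.kCoeff (r + 1) (KP.logOne (1 + KP.genSeries s.1.1))) =
      -fun s : KP.Solution => KP.kCoeff (r + 1) (KP.shift s.1.2.2) :=
    funext fun s => KP.kCoeff_succ_logOne s.2.2.1 s.2.2.2 r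
  have hS := K.D_D_mem_jetSpace KP.isShift_family hη
  have hR := K.eta_sub_mem_jetSpace KP.isShift_family hη
  choose S hS_hom hS using fun i j =>
    KP.exists_isWeightedHomogeneous_of_mem_weightSpace (hS i j)
  choose R hR_hom hR using fun r =>
    KP.exists_isWeightedHomogeneous_of_mem_weightSpace (hR r)
  refine ⟨fun r => R r.natPred, S, fun r => ?_, hS_hom, fun ξ τ v hξ hτ hv =>
    ⟨fun r => ?_, fun i j => ?_⟩⟩
  · simpa using hR_hom r.natPred
  · obtain ⟨r, rfl⟩ : ∃ i : ℕ, r = i.succPNat := ⟨r.natPred, by simp⟩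
    have := (KP.aeval_jet_apply _ _ _).symm.trans (congrFun (hR r) ⟨(ξ, τ, v), hξ, hτ, hv⟩)
    change KP.evalAt v _ = KP.eta ξ r.succPNat - ((r : ℚ) + 1)⁻¹ • KP.D r.succPNat v at this
    rw [← Rat.cast_smul_eq_qsmul ℂ] at this
    simp only [Nat.natPred_succPNat]
    rw [this]
    simp
  · exact ((KP.aeval_jet_apply _ _ _).symm.trans
      (congrFun (hS i j) ⟨(ξ, τ, v), hξ, hτ, hv⟩)).symm
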